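/- Notation. For a $6$-tuple such as $(0,0,0,12,13,14+23)$ we consider the real Lie algebra with basis $e_1,\dots,e_6$ and dual basis $e^1,\dots,e^6$ whose bracket is given by $e^k([x,y])=-de^k(x,y)$, where $de^k$ is the $k$-th entry of the tuple and $ij$ stands for $e^i\wedge e^j$ (for the tuple above, $[e_1,e_2]=-e_4$, $[e_1,e_3]=-e_5$, $[e_1,e_4]=[e_2,e_3]=-e_6$). A real Lie algebra $\mathfrak h$ is a CSLAT if it is nilpotent, its derivation algebra $\operatorname{Der}(\mathfrak h)$ is solvable, and every complex eigenvalue of every derivation of $\mathfrak h$ is real. Let \[ \mathfrak h_{13}=(0,0,0,12,13+14,24),\quad \mathfrak h_{19}^+=(0,0,0,23,21,14+35),\quad \mathfrak h_{26}^-=(0,0,12,31,32,15+24). \] For each of the $17$ Lie algebras $\mathfrak h_n$ below we list its tuple, a set $\Sigma=\Sigma_n$ of lower triangular $6\times 6$ matrices, and generators of a group $D=D_n$ of linear automorphisms; in $\Sigma$ the parameters $s_i$ range over $\mathbb R$ if they are off the diagonal and over $(0,\infty)$ if they are on the diagonal, and $\delta(\varepsilon_1,\dots,\varepsilon_6)$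 denotes the linear map $e_i\mapsto\varepsilon_i e_i$. - $\mathfrak h_{9}=(0,0,0,0,12,51+23)$: $\Sigma=\left\{\begin{pmatrix}1&0&0&0&0&0\\0&1&0&0&0&0\\0&0&s_{0}&0&0&0\\0&0&0&1&0&0\\0&0&s_{1}&s_{2}&s_{3}&0\\0&0&0&0&s_{4}&s_{5}\end{pmatrix}\right\}$, $D=\langle \delta(-1,1,1,1,-1,1),\ \delta(1,-1,1,1,-1,-1),\ \delta(1,1,1,-1,1,1)\rangle$. - $\mathfrak h_{10}=(0,0,0,12,13,14)$: $\Sigma=\left\{\begin{pmatrix}1&0&0&0&0&0\\0&1&0&0&0&0\\0&0&1&0&0&0\\0&0&0&s_{0}&0&0\\0&0&0&s_{1}&s_{2}&0\\0&0&0&s_{3}&s_{4}&s_{5}\end{pmatrix}\right\}$, $D=\langle \delta(-1,1,1,-1,-1,1),\ \delta(1,-1,1,-1,1,-1),\ \delta(1,1,-1,1,-1,1)\rangle$. - $\mathfrak h_{11}=(0,0,0,12,13,14+23)$: $\Sigma=\left\{\begin{pmatrix}1&0&0&0&0&0\\0&1&0&0&0&0\\0&0&s_{0}&0&0&0\\0&0&0&s_{1}&0&0\\0&0&0&s_{2}&s_{3}&0\\0&0&0&s_{4}&s_{5}&s_{6}\end{pmatrix}\right\}$,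 $D=\langle \delta(-1,1,1,-1,-1,1),\ \delta(1,-1,1,-1,1,-1)\rangle$. - $\mathfrak h_{12}=(0,0,0,12,13,24)$: $\Sigma=\left\{\begin{pmatrix}1&0&0&0&0&0\\s_{0}&1&0&0&0&0\\0&0&1&0&0&0\\0&0&s_{1}&s_{2}&0&0\\0&0&0&s_{3}&s_{4}&0\\0&0&0&s_{5}&s_{6}&s_{7}\end{pmatrix}\right\}$, $D=\langle \delta(-1,1,1,-1,-1,-1),\ \delta(1,-1,1,-1,1,1),\ \delta(1,1,-1,1,-1,1)\rangle$. - $\mathfrak h_{14}=(0,0,0,12,14,13+42)$: $\Sigma=\left\{\begin{pmatrix}1&0&0&0&0&0\\0&1&0&0&0&0\\0&0&s_{0}&0&0&0\\0&0&s_{1}&s_{2}&0&0\\0&0&0&s_{3}&s_{4}&0\\0&0&0&s_{5}&s_{6}&s_{7}\end{pmatrix}\right\}$, $D=\langle \delta(-1,1,1,-1,1,-1),\ \delta(1,-1,1,-1,-1,1)\rangle$. - $\mathfrak h_{18}=(0,0,0,12,13,15+24)$: $\Sigma=\left\{\begin{pmatrix}1&0&0&0&0&0\\0&1&0&0&0&0\\0&s_{0}&s_{1}&0&0&0\\0&0&s_{2}&s_{3}&0&0\\0&0&0&s_{4}&s_{5}&0\\0&0&0&s_{6}&s_{7}&s_{8}\end{pmatrix}\right\}$,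 $D=\langle \delta(-1,1,-1,-1,1,-1),\ \delta(1,-1,1,-1,1,1)\rangle$. - $\mathfrak h_{21}=(0,0,0,12,14,15)$: $\Sigma=\left\{\begin{pmatrix}1&0&0&0&0&0\\0&1&0&0&0&0\\0&0&1&0&0&0\\0&0&s_{0}&s_{1}&0&0\\0&0&s_{2}&s_{3}&s_{4}&0\\0&0&0&s_{5}&s_{6}&s_{7}\end{pmatrix}\right\}$, $D=\langle \delta(-1,1,1,-1,1,-1),\ \delta(1,-1,1,-1,-1,-1),\ \delta(1,1,-1,1,1,1)\rangle$. - $\mathfrak h_{22}=(0,0,0,12,14,15+24)$: $\Sigma=\left\{\begin{pmatrix}1&0&0&0&0&0\\0&s_{0}&0&0&0&0\\0&0&1&0&0&0\\0&0&s_{1}&s_{2}&0&0\\0&0&s_{3}&s_{4}&s_{5}&0\\0&0&0&s_{6}&s_{7}&s_{8}\end{pmatrix}\right\}$, $D=\langle \delta(-1,1,1,-1,1,-1),\ \delta(1,1,-1,1,1,1)\rangle$. - $\mathfrak h_{23}=(0,0,12,13,23,14)$: $\Sigma=\left\{\begin{pmatrix}1&0&0&0&0&0\\0&1&0&0&0&0\\0&0&s_{0}&0&0&0\\0&0&s_{1}&s_{2}&0&0\\0&0&s_{3}&s_{4}&s_{5}&0\\0&0&s_{6}&s_{7}&s_{8}&s_{9}\end{pmatrix}\right\}$,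 $D=\langle \delta(-1,1,-1,1,-1,-1),\ \delta(1,-1,-1,-1,1,-1)\rangle$. - $\mathfrak h_{24}=(0,0,0,12,14,15+23+24)$: $\Sigma=\left\{\begin{pmatrix}1&0&0&0&0&0\\0&s_{0}&0&0&0&0\\0&0&s_{1}&0&0&0\\0&0&s_{2}&s_{3}&0&0\\0&0&s_{4}&s_{5}&s_{6}&0\\0&0&0&s_{7}&s_{8}&s_{9}\end{pmatrix}\right\}$, $D=\langle \delta(-1,1,-1,-1,1,-1)\rangle$. - $\mathfrak h_{25}=(0,0,0,12,14,15+23)$: $\Sigma=\left\{\begin{pmatrix}1&0&0&0&0&0\\0&1&0&0&0&0\\0&0&s_{0}&0&0&0\\0&0&s_{1}&s_{2}&0&0\\0&0&s_{3}&s_{4}&s_{5}&0\\0&0&0&s_{6}&s_{7}&s_{8}\end{pmatrix}\right\}$, $D=\langle \delta(-1,1,-1,-1,1,-1),\ \delta(1,-1,1,-1,-1,-1)\rangle$. - $\mathfrak h_{27}=(0,0,0,12,14-23,15+34)$: $\Sigma=\left\{\begin{pmatrix}1&0&0&0&0&0\\0&1&0&0&0&0\\s_{0}&s_{1}&s_{2}&0&0&0\\0&0&s_{3}&s_{4}&0&0\\0&0&s_{5}&s_{6}&s_{7}&0\\0&0&0&s_{8}&s_{9}&s_{10}\end{pmatrix}\right\}$,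 $D=\langle \delta(-1,1,1,-1,1,-1),\ \delta(1,-1,1,-1,-1,-1)\rangle$. - $\mathfrak h_{28}=(0,0,12,13,14,15)$: $\Sigma=\left\{\begin{pmatrix}1&0&0&0&0&0\\0&1&0&0&0&0\\0&0&s_{0}&0&0&0\\0&0&s_{1}&s_{2}&0&0\\0&0&s_{3}&s_{4}&s_{5}&0\\0&0&s_{6}&s_{7}&s_{8}&s_{9}\end{pmatrix}\right\}$, $D=\langle \delta(-1,1,-1,1,-1,1),\ \delta(1,-1,-1,-1,-1,-1)\rangle$. - $\mathfrak h_{29}=(0,0,12,13,14,23+15)$: $\Sigma=\left\{\begin{pmatrix}1&0&0&0&0&0\\0&s_{0}&0&0&0&0\\0&0&s_{1}&0&0&0\\0&0&s_{2}&s_{3}&0&0\\0&0&s_{4}&s_{5}&s_{6}&0\\0&0&s_{7}&s_{8}&s_{9}&s_{10}\end{pmatrix}\right\}$, $D=\langle \delta(-1,-1,1,-1,1,-1)\rangle$. - $\mathfrak h_{30}=(0,0,12,13,14+23,24+15)$: $\Sigma=\left\{\begin{pmatrix}1&0&0&0&0&0\\s_{0}&s_{1}&0&0&0&0\\0&0&s_{2}&0&0&0\\0&0&s_{3}&s_{4}&0&0\\0&0&s_{5}&s_{6}&s_{7}&0\\0&0&s_{8}&s_{9}&s_{10}&s_{11}\end{pmatrix}\right\}$,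 $D=\langle \delta(-1,1,-1,1,-1,1)\rangle$. - $\mathfrak h_{31}=(0,0,12,13,14,34+52)$: $\Sigma=\left\{\begin{pmatrix}1&0&0&0&0&0\\s_{0}&1&0&0&0&0\\0&0&s_{1}&0&0&0\\0&s_{2}&s_{3}&s_{4}&0&0\\0&0&s_{5}&s_{6}&s_{7}&0\\0&0&s_{8}&s_{9}&s_{10}&s_{11}\end{pmatrix}\right\}$, $D=\langle \delta(-1,1,-1,1,-1,-1),\ \delta(1,-1,-1,-1,-1,1)\rangle$. - $\mathfrak h_{32}=(0,0,12,13,14+23,34+52)$: $\Sigma=\left\{\begin{pmatrix}1&0&0&0&0&0\\s_{0}&s_{1}&0&0&0&0\\0&0&s_{2}&0&0&0\\0&s_{3}&s_{4}&s_{5}&0&0\\0&0&s_{6}&s_{7}&s_{8}&0\\0&0&s_{9}&s_{10}&s_{11}&s_{12}\end{pmatrix}\right\}$, $D=\langle \delta(-1,1,-1,1,-1,-1)\rangle$. **Theorem.** Let $\mathfrak h$ be a $6$-dimensional CSLAT that is not isomorphic to $\mathfrak h_{13}$, $\mathfrak h_{19}^+$ or $\mathfrak h_{26}^-$, identified with one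 of the Lie algebras $\mathfrak h_n$ of the list by means of a standard basis $e_1,\dots,e_6$, that is, a basis in which its bracket is the one given by the tuple of $\mathfrak h_n$. For $\sigma\in\Sigma$ let $g_\sigma$ be the inner product on $\mathfrak h$ with matrix $\sigma^T\sigma$ in this basis. Then the isotropy group \[ K=\operatorname{Aut}(\mathfrak h)\cap \operatorname{O}(g_\sigma) \] is contained in $D$. Moreover $D$ is a finite $2$-group of automorphisms of $\mathfrak h$, each of which acts on the standard basis by $e_i\mapsto\pm e_i$. -/

import Mathlib

/-- The names of the isomorphism classes of six-dimensional real nilpotent Lie algebras that are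
characteristically solvable of triangular type. -/
inductive CSLATName where
  | h9 | h10 | h11 | h12 | h13 | h14 | h18 | h19plus | h21 | h22
  | h23 | h24 | h25 | h26minus | h27 | h28 | h29 | h30 | h31 | h32

namespace CSLATName

/-- Salamon's notation for the Lie algebras in their standard bases: the `k`-th entry lists the
pairs `(i, j)` such that `de^k = ∑ e^i ∧ e^j`.  For instance `[(1, 4), (2, 3)]` is `14 + 23`, and a
term `-ij` is written `ji`.  The numbers `1, …, 5` are the mathematical indices, so that the index
`i` refers to the coordinate `i - 1 : Fin 6`. -/
def salamon : CSLATName → Fin 6 → List (Fin 6 × Fin 6)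
  | h9 => ![[], [], [], [], [(1, 2)], [(5, 1), (2, 3)]]
  | h10 => ![[], [], [], [(1, 2)], [(1, 3)], [(1, 4)]]
  | h11 => ![[], [], [], [(1, 2)], [(1, 3)], [(1, 4), (2, 3)]]
  | h12 => ![[], [], [], [(1, 2)], [(1, 3)], [(2, 4)]]
  | h13 => ![[], [], [], [(1, 2)], [(1, 3), (1, 4)], [(2, 4)]]
  | h14 => ![[], [], [], [(1, 2)], [(1, 4)], [(1, 3), (4, 2)]]
  | h18 => ![[], [], [], [(1, 2)], [(1, 3)], [(1, 5), (2, 4)]]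
  | h19plus => ![[], [], [], [(2, 3)], [(2, 1)], [(1, 4), (3, 5)]]
  | h21 => ![[], [], [], [(1, 2)], [(1, 4)], [(1, 5)]]
  | h22 => ![[], [], [], [(1, 2)], [(1, 4)], [(1, 5), (2, 4)]]
  | h23 => ![[], [], [(1, 2)], [(1, 3)], [(2, 3)], [(1, 4)]]
  | h24 => ![[], [], [], [(1, 2)], [(1, 4)], [(1, 5), (2, 3), (2, 4)]]
  | h25 => ![[], [], [], [(1, 2)], [(1, 4)], [(1, 5), (2, 3)]]
  | h26minus => ![[], [], [(1, 2)], [(3, 1)], [(3, 2)], [(1, 5), (2, 4)]]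
  | h27 => ![[], [], [], [(1, 2)], [(1, 4), (3, 2)], [(1, 5), (3, 4)]]
  | h28 => ![[], [], [(1, 2)], [(1, 3)], [(1, 4)], [(1, 5)]]
  | h29 => ![[], [], [(1, 2)], [(1, 3)], [(1, 4)], [(2, 3), (1, 5)]]
  | h30 => ![[], [], [(1, 2)], [(1, 3)], [(1, 4), (2, 3)], [(2, 4), (1, 5)]]
  | h31 => ![[], [], [(1, 2)], [(1, 3)], [(1, 4)], [(3, 4), (5, 2)]]
  | h32 => ![[], [], [(1, 2)], [(1, 3)], [(1, 4), (2, 3)], [(3, 4), (5, 2)]]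

/-- The real vector space `ℝ⁶` underlying the Lie algebra with name `n`. -/
def Model (_n : CSLATName) : Type := Fin 6 → ℝ

namespace Model

variable {n : CSLATName}

instance : AddCommGroup (Model n) := inferInstanceAs (AddCommGroup (Fin 6 → ℝ))

instance : Module ℝ (Model n) := inferInstanceAs (Module ℝ (Fin 6 → ℝ))

/-- The Lie bracket: `e^k ([x, y]) = -de^k (x, y)`. -/
instance : Bracket (Model n) (Model n) where
  bracket x y := fun k =>
    -((n.salamon k).map fun p =>
        x (p.1 - 1) * y (p.2 - 1) - x (p.2 - 1) * y (p.1 - 1)).sum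

theorem lie_apply (x y : Model n) (k : Fin 6) :
    (⁅x, y⁆ : Model n) k = -((n.salamon k).map fun p =>
        x (p.1 - 1) * y (p.2 - 1) - x (p.2 - 1) * y (p.1 - 1)).sum := rfl

theorem add_apply (x y : Model n) (k : Fin 6) : (x + y) k = x k + y k := rfl

theorem smul_apply (r : ℝ) (x : Model n) (k : Fin 6) : (r • x) k = r * x k := rfl

theorem zero_apply (k : Fin 6) : (0 : Model n) k = 0 := rfl

instance : LieRing (Model n) where
  add_lie x y z := by
    funext k
    simp only [lie_apply, add_apply, ← neg_add, ← List.sum_map_add]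
    congr 3
    funext p
    ring
  lie_add x y z := by
    funext k
    simp only [lie_apply, add_apply, ← neg_add, ← List.sum_map_add]
    congr 3
    funext p
    ring
  lie_self x := by
    funext k
    simp [lie_apply, zero_apply, mul_comm]
  leibniz_lie x y z := by
    funext k
    cases n <;> fin_cases k <;>
      simp [lie_apply, add_apply, salamon] <;> ring

instance : LieAlgebra ℝ (Model n) where
  lie_smul r x y := by
    funext k
    simp only [lie_apply, smul_apply, mul_neg, ← List.sum_map_mul_left]
    congr 3
    funext p
    ring

end Model

/-- The canonical basis `e₁, …, e₆` of the Lie algebra with name `n`. -/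
noncomputable def stdBasis (n : CSLATName) : Module.Basis (Fin 6) ℝ n.Model :=
  Pi.basisFun ℝ (Fin 6)

/-- The generic element of the slice `Σ`, with parameters `s₀, s₁, …`. -/
def slice (n : CSLATName) (s : ℕ → ℝ) : Matrix (Fin 6) (Fin 6) ℝ :=
  match n with
  | h9 =>
    !![1, 0, 0, 0, 0, 0;
       0, 1, 0, 0, 0, 0;
       0, 0, s 0, 0, 0, 0;
       0, 0, 0, 1, 0, 0;
       0, 0, s 1, s 2, s 3, 0;
       0, 0, 0, 0, s 4, s 5]
  | h10 =>
    !![1, 0, 0, 0, 0, 0;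
       0, 1, 0, 0, 0, 0;
       0, 0, 1, 0, 0, 0;
       0, 0, 0, s 0, 0, 0;
       0, 0, 0, s 1, s 2, 0;
       0, 0, 0, s 3, s 4, s 5]
  | h11 =>
    !![1, 0, 0, 0, 0, 0;
       0, 1, 0, 0, 0, 0;
       0, 0, s 0, 0, 0, 0;
       0, 0, 0, s 1, 0, 0;
       0, 0, 0, s 2, s 3, 0;
       0, 0, 0, s 4, s 5, s 6]
  | h12 =>
    !![1, 0, 0, 0, 0, 0;
       s 0, 1, 0, 0, 0, 0;
       0, 0, 1, 0, 0, 0;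
       0, 0, s 1, s 2, 0, 0;
       0, 0, 0, s 3, s 4, 0;
       0, 0, 0, s 5, s 6, s 7]
  | h13 =>
    !![1, 0, 0, 0, 0, 0;
       s 0, 1, 0, 0, 0, 0;
       0, 0, s 1, 0, 0, 0;
       0, 0, s 2, s 3, 0, 0;
       0, 0, 0, s 4, s 5, 0;
       0, 0, 0, s 6, s 7, s 8]
  | h14 =>
    !![1, 0, 0, 0, 0, 0;
       0, 1, 0, 0, 0, 0;
       0, 0, s 0, 0, 0, 0;
       0, 0, s 1, s 2, 0, 0;
       0, 0, 0, s 3, s 4, 0;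
       0, 0, 0, s 5, s 6, s 7]
  | h18 =>
    !![1, 0, 0, 0, 0, 0;
       0, 1, 0, 0, 0, 0;
       0, s 0, s 1, 0, 0, 0;
       0, 0, s 2, s 3, 0, 0;
       0, 0, 0, s 4, s 5, 0;
       0, 0, 0, s 6, s 7, s 8]
  | h19plus =>
    !![1, 0, 0, 0, 0, 0;
       s 0, 1, 0, 0, 0, 0;
       s 1, s 2, 1, 0, 0, 0;
       0, 0, 0, s 3, 0, 0;
       s 4, 0, 0, s 5, s 6, 0;
       0, 0, 0, s 7, s 8, s 9]
  | h21 =>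
    !![1, 0, 0, 0, 0, 0;
       0, 1, 0, 0, 0, 0;
       0, 0, 1, 0, 0, 0;
       0, 0, s 0, s 1, 0, 0;
       0, 0, s 2, s 3, s 4, 0;
       0, 0, 0, s 5, s 6, s 7]
  | h22 =>
    !![1, 0, 0, 0, 0, 0;
       0, s 0, 0, 0, 0, 0;
       0, 0, 1, 0, 0, 0;
       0, 0, s 1, s 2, 0, 0;
       0, 0, s 3, s 4, s 5, 0;
       0, 0, 0, s 6, s 7, s 8]
  | h23 =>
    !![1, 0, 0, 0, 0, 0;
       0, 1, 0, 0, 0, 0;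
       0, 0, s 0, 0, 0, 0;
       0, 0, s 1, s 2, 0, 0;
       0, 0, s 3, s 4, s 5, 0;
       0, 0, s 6, s 7, s 8, s 9]
  | h24 =>
    !![1, 0, 0, 0, 0, 0;
       0, s 0, 0, 0, 0, 0;
       0, 0, s 1, 0, 0, 0;
       0, 0, s 2, s 3, 0, 0;
       0, 0, s 4, s 5, s 6, 0;
       0, 0, 0, s 7, s 8, s 9]
  | h25 =>
    !![1, 0, 0, 0, 0, 0;
       0, 1, 0, 0, 0, 0;
       0, 0, s 0, 0, 0, 0;
       0, 0, s 1, s 2, 0, 0;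
       0, 0, s 3, s 4, s 5, 0;
       0, 0, 0, s 6, s 7, s 8]
  | h26minus =>
    !![1, 0, 0, 0, 0, 0;
       s 0, 1, 0, 0, 0, 0;
       0, 0, s 1, 0, 0, 0;
       0, 0, s 2, s 3, 0, 0;
       0, 0, s 4, s 5, s 6, 0;
       0, 0, s 7, s 8, s 9, s 10]
  | h27 =>
    !![1, 0, 0, 0, 0, 0;
       0, 1, 0, 0, 0, 0;
       s 0, s 1, s 2, 0, 0, 0;
       0, 0, s 3, s 4, 0, 0;
       0, 0, s 5, s 6, s 7, 0;
       0, 0, 0, s 8, s 9, s 10]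
  | h28 =>
    !![1, 0, 0, 0, 0, 0;
       0, 1, 0, 0, 0, 0;
       0, 0, s 0, 0, 0, 0;
       0, 0, s 1, s 2, 0, 0;
       0, 0, s 3, s 4, s 5, 0;
       0, 0, s 6, s 7, s 8, s 9]
  | h29 =>
    !![1, 0, 0, 0, 0, 0;
       0, s 0, 0, 0, 0, 0;
       0, 0, s 1, 0, 0, 0;
       0, 0, s 2, s 3, 0, 0;
       0, 0, s 4, s 5, s 6, 0;
       0, 0, s 7, s 8, s 9, s 10]
  | h30 =>
    !![1, 0, 0, 0, 0, 0;
       s 0, s 1, 0, 0, 0, 0;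
       0, 0, s 2, 0, 0, 0;
       0, 0, s 3, s 4, 0, 0;
       0, 0, s 5, s 6, s 7, 0;
       0, 0, s 8, s 9, s 10, s 11]
  | h31 =>
    !![1, 0, 0, 0, 0, 0;
       s 0, 1, 0, 0, 0, 0;
       0, 0, s 1, 0, 0, 0;
       0, s 2, s 3, s 4, 0, 0;
       0, 0, s 5, s 6, s 7, 0;
       0, 0, s 8, s 9, s 10, s 11]
  | h32 =>
    !![1, 0, 0, 0, 0, 0;
       s 0, s 1, 0, 0, 0, 0;
       0, 0, s 2, 0, 0, 0;
       0, s 3, s 4, s 5, 0, 0;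
       0, 0, s 6, s 7, s 8, 0;
       0, 0, s 9, s 10, s 11, s 12]

/-- The slice `Σ`: the matrices of the prescribed shape, with arbitrary real parameters off the
diagonal and positive ones on the diagonal. -/
def Slice (n : CSLATName) : Set (Matrix (Fin 6) (Fin 6) ℝ) :=
  {σ | (∀ i, 0 < σ i i) ∧ ∃ s : ℕ → ℝ, σ = n.slice s}

/-- The matrices, in the standard basis, of the generators of the finite group `D` of
automorphisms. -/
def generators : CSLATName → Set (Matrix (Fin 6) (Fin 6) ℝ)
  | h9 =>
    { Matrix.diagonal ![-1, 1, 1, 1, -1, 1],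
      Matrix.diagonal ![1, -1, 1, 1, -1, -1],
      Matrix.diagonal ![1, 1, 1, -1, 1, 1] }
  | h10 =>
    { Matrix.diagonal ![-1, 1, 1, -1, -1, 1],
      Matrix.diagonal ![1, -1, 1, -1, 1, -1],
      Matrix.diagonal ![1, 1, -1, 1, -1, 1] }
  | h11 =>
    { Matrix.diagonal ![-1, 1, 1, -1, -1, 1],
      Matrix.diagonal ![1, -1, 1, -1, 1, -1] }
  | h12 =>
    { Matrix.diagonal ![-1, 1, 1, -1, -1, -1],
      Matrix.diagonal ![1, -1, 1, -1, 1, 1],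
      Matrix.diagonal ![1, 1, -1, 1, -1, 1] }
  | h13 =>
    { Matrix.diagonal ![-1, 1, -1, -1, 1, -1],
      Matrix.diagonal ![1, -1, -1, -1, -1, 1],
      !![0, -1, 0, 0, 0, 0;
        1, 0, 0, 0, 0, 0;
        0, 0, -1, 0, 0, 0;
        0, 0, 1, 1, 0, 0;
        0, 0, 0, 0, 0, -1;
        0, 0, 0, 0, 1, 0] }
  | h14 =>
    { Matrix.diagonal ![-1, 1, 1, -1, 1, -1],
      Matrix.diagonal ![1, -1, 1, -1, -1, 1] }
  | h18 =>
    { Matrix.diagonal ![-1, 1, -1, -1, 1, -1],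
      Matrix.diagonal ![1, -1, 1, -1, 1, 1] }
  | h19plus =>
    { Matrix.diagonal ![-1, 1, 1, 1, -1, -1],
      Matrix.diagonal ![1, -1, 1, -1, -1, -1],
      !![0, 0, 1, 0, 0, 0;
        0, 1, 0, 0, 0, 0;
        1, 0, 0, 0, 0, 0;
        0, 0, 0, 0, 1, 0;
        0, 0, 0, 1, 0, 0;
        0, 0, 0, 0, 0, 1] }
  | h21 =>
    { Matrix.diagonal ![-1, 1, 1, -1, 1, -1],
      Matrix.diagonal ![1, -1, 1, -1, -1, -1],
      Matrix.diagonal ![1, 1, -1, 1, 1, 1] }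
  | h22 =>
    { Matrix.diagonal ![-1, 1, 1, -1, 1, -1],
      Matrix.diagonal ![1, 1, -1, 1, 1, 1] }
  | h23 =>
    { Matrix.diagonal ![-1, 1, -1, 1, -1, -1],
      Matrix.diagonal ![1, -1, -1, -1, 1, -1] }
  | h24 =>
    { Matrix.diagonal ![-1, 1, -1, -1, 1, -1] }
  | h25 =>
    { Matrix.diagonal ![-1, 1, -1, -1, 1, -1],
      Matrix.diagonal ![1, -1, 1, -1, -1, -1] }
  | h26minus =>
    { Matrix.diagonal ![-1, 1, -1, 1, -1, 1],
      !![0, 1, 0, 0, 0, 0;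
        1, 0, 0, 0, 0, 0;
        0, 0, -1, 0, 0, 0;
        0, 0, 0, 0, -1, 0;
        0, 0, 0, -1, 0, 0;
        0, 0, 0, 0, 0, -1] }
  | h27 =>
    { Matrix.diagonal ![-1, 1, 1, -1, 1, -1],
      Matrix.diagonal ![1, -1, 1, -1, -1, -1] }
  | h28 =>
    { Matrix.diagonal ![-1, 1, -1, 1, -1, 1],
      Matrix.diagonal ![1, -1, -1, -1, -1, -1] }
  | h29 =>
    { Matrix.diagonal ![-1, -1, 1, -1, 1, -1] }
  | h30 =>
    { Matrix.diagonal ![-1, 1, -1, 1, -1, 1] }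
  | h31 =>
    { Matrix.diagonal ![-1, 1, -1, 1, -1, -1],
      Matrix.diagonal ![1, -1, -1, -1, -1, 1] }
  | h32 =>
    { Matrix.diagonal ![-1, 1, -1, 1, -1, -1] }

end CSLATName

section

variable {h : Type*} [LieRing h] [LieAlgebra ℝ h]

/-- The Lie algebra `h` is a CSLAT: it is nilpotent, its derivation algebra is solvable, and every
complex eigenvalue of every derivation is real. -/
structure IsCSLAT (h : Type*) [LieRing h] [LieAlgebra ℝ h] : Prop where
  nilpotent : LieRing.IsNilpotent h
  solvable : LieAlgebra.IsSolvable (LieDerivation ℝ h h)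
  real_spectrum : ∀ (δ : LieDerivation ℝ h h) (z : ℂ),
    z ∈ spectrum ℂ (LinearMap.baseChange ℂ (δ : h →ₗ[ℝ] h)) → z.im = 0

/-- `e` is a standard basis of `h` of type `n`: the linear map taking `e` to the canonical basis of
the model is an isomorphism of Lie algebras. -/
def IsStandardBasis (n : CSLATName) (e : Module.Basis (Fin 6) ℝ h) : Prop :=
  ∃ ψ : h ≃ₗ⁅ℝ⁆ n.Model, ∀ i, ψ (e i) = n.stdBasis i

/-- The automorphism group of a real Lie algebra. -/
def lieAut (h : Type*) [LieRing h] [LieAlgebra ℝ h] : Subgroup (h ≃ₗ[ℝ] h) where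
  carrier := {φ | ∀ x y, φ ⁅x, y⁆ = ⁅φ x, φ y⁆}
  mul_mem' := by
    intro a b ha hb x y
    simp only [LinearEquiv.mul_apply]
    rw [hb, ha]
  one_mem' := fun _ _ => rfl
  inv_mem' := by
    intro a ha x y
    apply a.injective
    have key : ∀ z, a (a⁻¹ z) = z := a.apply_symm_apply
    rw [ha, key, key, key]

/-- The orthogonal group of a bilinear form. -/
def orthogonalOf (g : LinearMap.BilinForm ℝ h) : Subgroup (h ≃ₗ[ℝ] h) where
  carrier := {φ | ∀ x y, g (φ x) (φ y) = g x y}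
  mul_mem' := by
    intro a b ha hb x y
    simp only [LinearEquiv.mul_apply]
    rw [ha, hb]
  one_mem' := fun _ _ => rfl
  inv_mem' := by
    intro a ha x y
    have key : ∀ z, a (a⁻¹ z) = z := a.apply_symm_apply
    rw [← ha, key, key]

/-- The inner product `g_σ` on `h` whose matrix in the basis `e` is `σᵀ σ`. -/
noncomputable def metricOf (e : Module.Basis (Fin 6) ℝ h) (σ : Matrix (Fin 6) (Fin 6) ℝ) :
    LinearMap.BilinForm ℝ h :=
  Matrix.toBilin e (σ.transpose * σ)

/-- The isotropy group `K = Aut(h) ∩ O(g_σ)`. -/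
noncomputable def isotropyGroup (e : Module.Basis (Fin 6) ℝ h) (σ : Matrix (Fin 6) (Fin 6) ℝ) :
    Subgroup (h ≃ₗ[ℝ] h) :=
  lieAut h ⊓ orthogonalOf (metricOf e σ)

/-- The finite group `D`, generated by the linear automorphisms whose matrices in the basis `e` are
the generators listed for `n`. -/
noncomputable def finiteGroupD (n : CSLATName) (e : Module.Basis (Fin 6) ℝ h) :
    Subgroup (h ≃ₗ[ℝ] h) :=
  Subgroup.closure {φ | LinearMap.toMatrix e e (φ : h →ₗ[ℝ] h) ∈ n.generators}

end

/-! In each of the seventeen algebras the spans of $e_i,\dots,e_6$ are built from one another by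
operations natural under automorphisms (brackets, centralizers and their relative versions, sums,
intersections), with one ad hoc step for `h14`. Hence every automorphism has a lower triangular
matrix $A$ in the standard basis (`hasCharFlag`). The matrix $\sigma$ is lower triangular as well.
If $A$ preserves $\sigma^T\sigma$, then $\sigma A\sigma^{-1}$ is both orthogonal and lower
triangular, hence a diagonal sign matrix (`exists_mul_eq_diagonal_mul`). So $\sigma
A=\operatorname{diag}(d)\,\sigma$ with $d_i=\pm1$, which fixes the diagonal of $A$ and relates its
entries below the diagonal to those of $\sigma$. These linear relations, with the zeros prescribed
in $\Sigma$, and the polynomial equations expressing that $A$ is an automorphism force $A$ to be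
diagonal (`apply_eq_zero_of_mem_slice`). A sign vector $\varepsilon$ defines an automorphism once
$\varepsilon_k=\varepsilon_i\varepsilon_j$ for each term $ij$ of $de^k$, and an isotropy satisfies
these conditions. Enumerating the 64 sign vectors shows that all solutions are products of the
listed generators (`exists_sublist_prod_eq`). Since $D$ is the image of a subgroup of $\{\pm1\}^6$,
the remaining claims follow. -/

namespace CSLATName

/-! ### Structure constants -/

/-- The structure constants in the standard basis: `[e_i, e_j] = ∑ k, structConst n k i j • e_k`. -/
def structConst (n : CSLATName) (k i j : Fin 6) : ℤ :=
  -((n.salamon k).map fun p =>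
      (if p.1 - 1 = i ∧ p.2 - 1 = j then 1 else 0) -
        (if p.2 - 1 = i ∧ p.1 - 1 = j then 1 else 0)).sum

namespace Model

variable {n : CSLATName}

/-- Passing to integer structure constants turns inclusions between brackets of coordinate subspaces
into finite statements that `decide` can check. -/
theorem lie_apply_eq_sum (x y : n.Model) (k : Fin 6) :
    (⁅x, y⁆ : n.Model) k = ∑ i, ∑ j, (n.structConst k i j : ℝ) * (x i * y j) := by
  simp only [lie_apply, structConst]
  generalize n.salamon k = l
  induction l with
  | nil => simp
  | cons p l ih =>
    have h : ∀ a b : Fin 6, ∑ i, ∑ j, (if a = i ∧ b = j then x i * y j else 0) = x a * y b := by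
      intro a b
      simp [ite_and]
    simp only [List.map_cons, List.sum_cons, neg_add, Int.cast_add, add_mul,
      Finset.sum_add_distrib, ih]
    congr 1
    simp only [Int.cast_sub, Int.cast_ite, Int.cast_one, Int.cast_zero, neg_sub,
      sub_mul, ite_mul, one_mul, zero_mul, Finset.sum_sub_distrib, h]

theorem stdBasis_apply (i j : Fin 6) : n.stdBasis i j = if j = i then 1 else 0 := by
  change (Pi.basisFun ℝ (Fin 6) i : Fin 6 → ℝ) j = _
  simp [Pi.single_apply]

theorem stdBasis_repr (x : n.Model) (i : Fin 6) : n.stdBasis.repr x i = x i :=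
  Pi.basisFun_repr (R := ℝ) (η := Fin 6) x i

theorem sum_smul_stdBasis (x : n.Model) : ∑ i, x i • n.stdBasis i = x := by
  simpa [stdBasis_repr] using n.stdBasis.sum_repr x

theorem lie_stdBasis_apply (x : n.Model) (j k : Fin 6) :
    (⁅x, n.stdBasis j⁆ : n.Model) k = ∑ i, (n.structConst k i j : ℝ) * x i := by
  simp [lie_apply_eq_sum, stdBasis_apply]

theorem lie_stdBasis_stdBasis (i j : Fin 6) :
    ⁅n.stdBasis i, n.stdBasis j⁆ = ∑ k, (n.structConst k i j : ℝ) • n.stdBasis k := by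
  rw [← sum_smul_stdBasis ⁅n.stdBasis i, n.stdBasis j⁆]
  simp [lie_stdBasis_apply, stdBasis_apply]

/-! ### Characteristic coordinate subspaces -/

/-- The subspace spanned by the `e_i` with `i ∈ s`. -/
def coord (n : CSLATName) (s : Finset (Fin 6)) : Submodule ℝ n.Model where
  carrier := {x | ∀ i ∉ s, x i = 0}
  add_mem' hx hy i hi := by rw [add_apply, hx i hi, hy i hi, add_zero]
  zero_mem' i _ := zero_apply i
  smul_mem' r x hx i hi := by rw [smul_apply, hx i hi, mul_zero]

theorem mem_coord {s : Finset (Fin 6)} {x : n.Model} : x ∈ coord n s ↔ ∀ i ∉ s, x i = 0 :=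
  Iff.rfl

theorem stdBasis_mem_coord {s : Finset (Fin 6)} {i : Fin 6} :
    n.stdBasis i ∈ coord n s ↔ i ∈ s := by
  simp only [mem_coord, stdBasis_apply, ite_eq_right_iff, one_ne_zero, imp_false]
  grind

/-- The span of the `e_i` with `i ∈ s` is invariant under all automorphisms. -/
def IsChar (n : CSLATName) (s : Finset (Fin 6)) : Prop :=
  ∀ f ∈ lieAut n.Model, ∀ x ∈ coord n s, f x ∈ coord n s

/-- The bracket maps `⟨e_i | i ∈ s⟩ × ⟨e_j | j ∈ t⟩` to `⟨e_k | k ∈ u⟩`. -/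
def BracketLE (n : CSLATName) (s t u : Finset (Fin 6)) : Prop :=
  ∀ k ∉ u, ∀ i ∈ s, ∀ j ∈ t, n.structConst k i j = 0

instance (s t u : Finset (Fin 6)) : Decidable (BracketLE n s t u) :=
  inferInstanceAs (Decidable (∀ _, _))

theorem BracketLE.lie_mem {s t u : Finset (Fin 6)} (h : BracketLE n s t u) {x y : n.Model}
    (hx : x ∈ coord n s) (hy : y ∈ coord n t) : ⁅x, y⁆ ∈ coord n u := by
  intro k hk
  rw [lie_apply_eq_sum]
  refine Finset.sum_eq_zero fun i _ => Finset.sum_eq_zero fun j _ => ?_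
  by_cases hi : i ∈ s
  · by_cases hj : j ∈ t
    · simp [h k hk i hi j hj]
    · simp [hy j hj]
  · simp [hx i hi]

theorem isChar_univ : IsChar n Finset.univ := fun _ _ _ _ i hi => absurd (Finset.mem_univ i) hi

theorem isChar_empty : IsChar n ∅ := by
  intro f _ x hx
  have : x = 0 := funext fun i => hx i (Finset.notMem_empty i)
  rw [this, map_zero]
  exact Submodule.zero_mem _

theorem IsChar.inter {s t : Finset (Fin 6)} (hs : IsChar n s) (ht : IsChar n t) :
    IsChar n (s ∩ t) := by
  intro f hf x hx i hi
  rw [Finset.mem_inter, not_and_or] at hi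
  have hx' : x ∈ coord n s ∧ x ∈ coord n t :=
    ⟨fun j hj => hx j (by simp [hj]), fun j hj => hx j (by simp [hj])⟩
  exact hi.elim (hs f hf x hx'.1 i) (ht f hf x hx'.2 i)

theorem isChar_iff_stdBasis {s : Finset (Fin 6)} :
    IsChar n s ↔ ∀ f ∈ lieAut n.Model, ∀ i ∈ s, f (n.stdBasis i) ∈ coord n s := by
  refine ⟨fun h f hf i hi => h f hf _ (stdBasis_mem_coord.2 hi), fun h f hf x hx => ?_⟩
  rw [← sum_smul_stdBasis x, map_sum]
  refine Submodule.sum_mem _ fun i _ => ?_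
  rw [map_smul]
  by_cases hi : i ∈ s
  · exact Submodule.smul_mem _ _ (h f hf i hi)
  · rw [hx i hi, zero_smul]
    exact Submodule.zero_mem _

theorem IsChar.union {s t : Finset (Fin 6)} (hs : IsChar n s) (ht : IsChar n t) :
    IsChar n (s ∪ t) := by
  rw [isChar_iff_stdBasis] at *
  intro f hf i hi
  rcases Finset.mem_union.1 hi with hi | hi
  · exact fun j hj => hs f hf i hi j fun h => hj (Finset.mem_union_left _ h)
  · exact fun j hj => ht f hf i hi j fun h => hj (Finset.mem_union_right _ h)

/-- Brackets of characteristic subspaces are characteristic. -/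
theorem IsChar.bracket {s t : Finset (Fin 6)} (hs : IsChar n s) (ht : IsChar n t)
    (u : Finset (Fin 6)) (h : BracketLE n s t u)
    (h' : ∀ k ∈ u, ∃ i ∈ s, ∃ j ∈ t, n.structConst k i j ≠ 0 ∧
      ∀ l, l ≠ k → n.structConst l i j = 0) : IsChar n u := by
  rw [isChar_iff_stdBasis]
  intro f hf k hk
  -- `h` and `h'` together say that $[s,t]$ spans exactly the subspace of $u$: each $e_k$ with $k\in
  -- u$ is a nonzero multiple of a single bracket $[e_i,e_j]$.
  obtain ⟨i, hi, j, hj, hne, hz⟩ := h' k hk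
  have hlie : ⁅n.stdBasis i, n.stdBasis j⁆ = (n.structConst k i j : ℝ) • n.stdBasis k := by
    rw [lie_stdBasis_stdBasis, Finset.sum_eq_single k (fun l _ hl => by simp [hz l hl]) (by simp)]
  have hmem := h.lie_mem (hs f hf _ (stdBasis_mem_coord.2 hi)) (ht f hf _ (stdBasis_mem_coord.2 hj))
  rw [← hf, hlie, map_smul] at hmem
  exact (Submodule.smul_mem_iff _ (Int.cast_ne_zero.2 hne)).1 hmem

/-- The transporter `{x | [x, s] ⊆ t}` of characteristic subspaces is characteristic. -/
theorem IsChar.transporter {s t : Finset (Fin 6)} (hs : IsChar n s) (ht : IsChar n t)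
    (u : Finset (Fin 6)) (h : BracketLE n u s t)
    (h' : ∀ i ∉ u, ∃ j ∈ s, ∃ k ∉ t, n.structConst k i j ≠ 0 ∧
      ∀ l, l ≠ i → n.structConst k l j = 0) : IsChar n u := by
  intro f hf x hx i hi
  -- The bracket $[f x,e_j]=f[x,f^{-1}e_j]$ lies in the subspace of $t$, and its $k$-th coordinate
  -- is a nonzero multiple of $(f x)_i$.
  obtain ⟨j, hj, k, hk, hne, hz⟩ := h' i hi
  have hmem := ht f hf _ (h.lie_mem hx (hs f⁻¹ (inv_mem hf) _ (stdBasis_mem_coord.2 hj))) k hk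
  have hinv : f (f⁻¹ (n.stdBasis j)) = n.stdBasis j := f.apply_symm_apply _
  rw [hf, hinv, lie_stdBasis_apply,
    Finset.sum_eq_single i (fun l _ hl => by simp [hz l hl]) (by simp)] at hmem
  exact (mul_eq_zero.1 hmem).resolve_left (Int.cast_ne_zero.2 hne)

/-- The standard flag consists of characteristic subspaces. -/
def HasCharFlag (n : CSLATName) : Prop := ∀ i, IsChar n (Finset.Ici i)

theorem HasCharFlag.of_Ici (h1 : IsChar n (Finset.Ici 1)) (h2 : IsChar n (Finset.Ici 2))
    (h3 : IsChar n (Finset.Ici 3)) (h4 : IsChar n (Finset.Ici 4)) (h5 : IsChar n (Finset.Ici 5)) :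
    HasCharFlag n := by
  intro i
  fin_cases i
  exacts [isChar_univ, h1, h2, h3, h4, h5]

theorem HasCharFlag.apply_eq_zero (h : HasCharFlag n) {f : n.Model ≃ₗ[ℝ] n.Model}
    (hf : f ∈ lieAut n.Model) {i j : Fin 6} (hij : i < j) : f (n.stdBasis j) i = 0 :=
  h j f hf _ (stdBasis_mem_coord.2 (Finset.mem_Ici.2 le_rfl)) i (by simpa using hij)

/-! ### Invariance of the standard flag, algebra by algebra -/

theorem hasCharFlag_h9 : HasCharFlag h9 := by
  -- The center, the transporter of the whole algebra into zero. It is not a member of the flag, but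
  -- its sum with the derived algebra is.
  have hz : IsChar h9 {3, 5} :=
    isChar_univ.transporter isChar_empty _ (by decide) (by decide)
  have hc4 : IsChar h9 (Finset.Ici 4) := isChar_univ.bracket isChar_univ _ (by decide) (by decide)
  have hc5 : IsChar h9 (Finset.Ici 5) := isChar_univ.bracket hc4 _ (by decide) (by decide)
  have hc3 : IsChar h9 (Finset.Ici 3) := hz.union hc4
  have hc2 : IsChar h9 (Finset.Ici 2) := isChar_univ.transporter hz _ (by decide) (by decide)
  have hc1 : IsChar h9 (Finset.Ici 1) := hc4.transporter isChar_empty _ (by decide) (by decide)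
  exact .of_Ici hc1 hc2 hc3 hc4 hc5

theorem hasCharFlag_h10 : HasCharFlag h10 := by
  have hc4 : IsChar h10 (Finset.Ici 4) :=
    isChar_univ.transporter isChar_empty _ (by decide) (by decide)
  have hc3 : IsChar h10 (Finset.Ici 3) := isChar_univ.bracket isChar_univ _ (by decide) (by decide)
  have hc5 : IsChar h10 (Finset.Ici 5) := isChar_univ.bracket hc3 _ (by decide) (by decide)
  have hc2 : IsChar h10 (Finset.Ici 2) := isChar_univ.transporter hc4 _ (by decide) (by decide)
  have hc1 : IsChar h10 (Finset.Ici 1) := hc3.transporter isChar_empty _ (by decide) (by decide)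
  exact .of_Ici hc1 hc2 hc3 hc4 hc5

theorem hasCharFlag_h11 : HasCharFlag h11 := by
  have hc4 : IsChar h11 (Finset.Ici 4) :=
    isChar_univ.transporter isChar_empty _ (by decide) (by decide)
  have hc3 : IsChar h11 (Finset.Ici 3) := isChar_univ.bracket isChar_univ _ (by decide) (by decide)
  have hc5 : IsChar h11 (Finset.Ici 5) := isChar_univ.bracket hc3 _ (by decide) (by decide)
  have hc2 : IsChar h11 (Finset.Ici 2) := isChar_univ.transporter hc4 _ (by decide) (by decide)
  have hc1 : IsChar h11 (Finset.Ici 1) := hc3.transporter isChar_empty _ (by decide) (by decide)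
  exact .of_Ici hc1 hc2 hc3 hc4 hc5

theorem hasCharFlag_h12 : HasCharFlag h12 := by
  have hc4 : IsChar h12 (Finset.Ici 4) :=
    isChar_univ.transporter isChar_empty _ (by decide) (by decide)
  have hc3 : IsChar h12 (Finset.Ici 3) := isChar_univ.bracket isChar_univ _ (by decide) (by decide)
  have hc5 : IsChar h12 (Finset.Ici 5) := isChar_univ.bracket hc3 _ (by decide) (by decide)
  have hc2 : IsChar h12 (Finset.Ici 2) := isChar_univ.transporter hc4 _ (by decide) (by decide)
  have hc1 : IsChar h12 (Finset.Ici 1) := hc2.transporter hc5 _ (by decide) (by decide)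
  exact .of_Ici hc1 hc2 hc3 hc4 hc5

theorem hasCharFlag_h14 : HasCharFlag h14 := by
  have hc4 : IsChar h14 (Finset.Ici 4) :=
    isChar_univ.transporter isChar_empty _ (by decide) (by decide)
  have hc3 : IsChar h14 (Finset.Ici 3) := isChar_univ.bracket isChar_univ _ (by decide) (by decide)
  have hc2 : IsChar h14 (Finset.Ici 2) := isChar_univ.transporter hc4 _ (by decide) (by decide)
  -- No bracket or transporter is used for this term. Instead, $e_2$ and $e_3$ commute, hence so do
  -- their images. If $f e_2$ had a nonzero $e_1$-coordinate, this would kill the $e_4$- and then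
  -- the $e_3$-coordinate of $f e_3$, making $f e_3$ central although $e_3$ is not.
  have hc1 : IsChar h14 (Finset.Ici 1) := by
    rw [isChar_iff_stdBasis]
    intro f hf i hi
    have hcases : i = 1 ∨ i ∈ Finset.Ici (2 : Fin 6) := by
      revert hi
      revert i
      decide
    rcases hcases with rfl | hi
    · have h2 := hc2 f hf _ (stdBasis_mem_coord.2 (Finset.mem_Ici.2 le_rfl))
      have hlie : ⁅f (h14.stdBasis 1), f (h14.stdBasis 2)⁆ = 0 := by
        have hz : ∀ k, h14.structConst k 1 2 = 0 := by decide
        rw [← hf, lie_stdBasis_stdBasis]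
        simp [hz]
      have h0 := h2 0 (by decide)
      have h1 := h2 1 (by decide)
      have e4 := congrFun hlie 4
      have e5 := congrFun hlie 5
      simp [lie_apply, salamon, zero_apply, h0, h1] at e4 e5
      have key : f (h14.stdBasis 1) 0 = 0 := by
        by_contra hne
        have h3 : f (h14.stdBasis 2) 3 = 0 := by grind
        have h4 : f (h14.stdBasis 2) 2 = 0 := by grind
        have hmem : f (h14.stdBasis 2) ∈ coord h14 (Finset.Ici 4) := by
          intro k hk
          fin_cases k
          exacts [h0, h1, h4, h3, absurd (by decide) hk, absurd (by decide) hk]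
        have hinv := hc4 f⁻¹ (inv_mem hf) _ hmem
        rw [show f⁻¹ (f (h14.stdBasis 2)) = h14.stdBasis 2 from f.symm_apply_apply _,
          stdBasis_mem_coord] at hinv
        exact absurd hinv (by decide)
      intro k hk
      have : k = 0 := by
        revert k
        decide
      rw [this, key]
    · intro k hk
      exact hc2 f hf _ (stdBasis_mem_coord.2 hi) k fun h => hk (by revert h; revert k; decide)
  have hc5 : IsChar h14 (Finset.Ici 5) := hc1.bracket hc3 _ (by decide) (by decide)
  exact .of_Ici hc1 hc2 hc3 hc4 hc5

theorem hasCharFlag_h18 : HasCharFlag h18 := by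
  have hc5 : IsChar h18 (Finset.Ici 5) :=
    isChar_univ.transporter isChar_empty _ (by decide) (by decide)
  have hc3 : IsChar h18 (Finset.Ici 3) := isChar_univ.bracket isChar_univ _ (by decide) (by decide)
  have hc2 : IsChar h18 (Finset.Ici 2) := hc3.transporter isChar_empty _ (by decide) (by decide)
  have hc4 : IsChar h18 (Finset.Ici 4) := isChar_univ.bracket hc2 _ (by decide) (by decide)
  have hc1 : IsChar h18 (Finset.Ici 1) := hc2.transporter hc5 _ (by decide) (by decide)
  exact .of_Ici hc1 hc2 hc3 hc4 hc5

theorem hasCharFlag_h21 : HasCharFlag h21 := by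
  have hz : IsChar h21 {2, 5} :=
    isChar_univ.transporter isChar_empty _ (by decide) (by decide)
  have hc3 : IsChar h21 (Finset.Ici 3) := isChar_univ.bracket isChar_univ _ (by decide) (by decide)
  have hc4 : IsChar h21 (Finset.Ici 4) := isChar_univ.bracket hc3 _ (by decide) (by decide)
  have hc2 : IsChar h21 (Finset.Ici 2) := hz.union hc3
  have hc5 : IsChar h21 (Finset.Ici 5) := hz.inter hc3
  have hc1 : IsChar h21 (Finset.Ici 1) := hc3.transporter isChar_empty _ (by decide) (by decide)
  exact .of_Ici hc1 hc2 hc3 hc4 hc5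

theorem hasCharFlag_h22 : HasCharFlag h22 := by
  have hz : IsChar h22 {2, 5} :=
    isChar_univ.transporter isChar_empty _ (by decide) (by decide)
  have hc3 : IsChar h22 (Finset.Ici 3) := isChar_univ.bracket isChar_univ _ (by decide) (by decide)
  have hc4 : IsChar h22 (Finset.Ici 4) := isChar_univ.bracket hc3 _ (by decide) (by decide)
  have hc2 : IsChar h22 (Finset.Ici 2) := hz.union hc3
  have hc5 : IsChar h22 (Finset.Ici 5) := hz.inter hc3
  have hc1 : IsChar h22 (Finset.Ici 1) := hc3.transporter hz _ (by decide) (by decide)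
  exact .of_Ici hc1 hc2 hc3 hc4 hc5

theorem hasCharFlag_h23 : HasCharFlag h23 := by
  have hc4 : IsChar h23 (Finset.Ici 4) :=
    isChar_univ.transporter isChar_empty _ (by decide) (by decide)
  have hc2 : IsChar h23 (Finset.Ici 2) := isChar_univ.bracket isChar_univ _ (by decide) (by decide)
  have hc3 : IsChar h23 (Finset.Ici 3) := isChar_univ.transporter hc4 _ (by decide) (by decide)
  have hc1 : IsChar h23 (Finset.Ici 1) := hc2.transporter hc4 _ (by decide) (by decide)
  have hc5 : IsChar h23 (Finset.Ici 5) := isChar_univ.bracket hc3 _ (by decide) (by decide)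
  exact .of_Ici hc1 hc2 hc3 hc4 hc5

theorem hasCharFlag_h24 : HasCharFlag h24 := by
  have hc3 : IsChar h24 (Finset.Ici 3) := isChar_univ.bracket isChar_univ _ (by decide) (by decide)
  have hc4 : IsChar h24 (Finset.Ici 4) := isChar_univ.bracket hc3 _ (by decide) (by decide)
  have hc5 : IsChar h24 (Finset.Ici 5) := isChar_univ.bracket hc4 _ (by decide) (by decide)
  have hc2 : IsChar h24 (Finset.Ici 2) := hc3.transporter isChar_empty _ (by decide) (by decide)
  have hc1 : IsChar h24 (Finset.Ici 1) := hc3.transporter hc5 _ (by decide) (by decide)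
  exact .of_Ici hc1 hc2 hc3 hc4 hc5

theorem hasCharFlag_h25 : HasCharFlag h25 := by
  have hc5 : IsChar h25 (Finset.Ici 5) :=
    isChar_univ.transporter isChar_empty _ (by decide) (by decide)
  have hc3 : IsChar h25 (Finset.Ici 3) := isChar_univ.bracket isChar_univ _ (by decide) (by decide)
  have hc4 : IsChar h25 (Finset.Ici 4) := isChar_univ.bracket hc3 _ (by decide) (by decide)
  -- The second term of the upper central series lies outside the flag; the third term is the span
  -- of $e_3,\dots,e_6$.
  have hz : IsChar h25 {2, 4, 5} := isChar_univ.transporter hc5 _ (by decide) (by decide)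
  have hc1 : IsChar h25 (Finset.Ici 1) := hc3.transporter isChar_empty _ (by decide) (by decide)
  have hc2 : IsChar h25 (Finset.Ici 2) := isChar_univ.transporter hz _ (by decide) (by decide)
  exact .of_Ici hc1 hc2 hc3 hc4 hc5

theorem hasCharFlag_h27 : HasCharFlag h27 := by
  have hc5 : IsChar h27 (Finset.Ici 5) :=
    isChar_univ.transporter isChar_empty _ (by decide) (by decide)
  have hc3 : IsChar h27 (Finset.Ici 3) := isChar_univ.bracket isChar_univ _ (by decide) (by decide)
  have hc4 : IsChar h27 (Finset.Ici 4) := isChar_univ.transporter hc5 _ (by decide) (by decide)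
  have hc1 : IsChar h27 (Finset.Ici 1) := hc3.transporter hc5 _ (by decide) (by decide)
  have hc2 : IsChar h27 (Finset.Ici 2) := isChar_univ.transporter hc4 _ (by decide) (by decide)
  exact .of_Ici hc1 hc2 hc3 hc4 hc5

theorem hasCharFlag_h28 : HasCharFlag h28 := by
  have hc5 : IsChar h28 (Finset.Ici 5) :=
    isChar_univ.transporter isChar_empty _ (by decide) (by decide)
  have hc2 : IsChar h28 (Finset.Ici 2) := isChar_univ.bracket isChar_univ _ (by decide) (by decide)
  have hc4 : IsChar h28 (Finset.Ici 4) := isChar_univ.transporter hc5 _ (by decide) (by decide)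
  have hc3 : IsChar h28 (Finset.Ici 3) := isChar_univ.bracket hc2 _ (by decide) (by decide)
  have hc1 : IsChar h28 (Finset.Ici 1) := hc2.transporter isChar_empty _ (by decide) (by decide)
  exact .of_Ici hc1 hc2 hc3 hc4 hc5

theorem hasCharFlag_h29 : HasCharFlag h29 := by
  have hc5 : IsChar h29 (Finset.Ici 5) :=
    isChar_univ.transporter isChar_empty _ (by decide) (by decide)
  have hc2 : IsChar h29 (Finset.Ici 2) := isChar_univ.bracket isChar_univ _ (by decide) (by decide)
  have hc4 : IsChar h29 (Finset.Ici 4) := isChar_univ.transporter hc5 _ (by decide) (by decide)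
  have hc3 : IsChar h29 (Finset.Ici 3) := isChar_univ.bracket hc2 _ (by decide) (by decide)
  have hc1 : IsChar h29 (Finset.Ici 1) := hc2.transporter hc5 _ (by decide) (by decide)
  exact .of_Ici hc1 hc2 hc3 hc4 hc5

theorem hasCharFlag_h30 : HasCharFlag h30 := by
  have hc5 : IsChar h30 (Finset.Ici 5) :=
    isChar_univ.transporter isChar_empty _ (by decide) (by decide)
  have hc2 : IsChar h30 (Finset.Ici 2) := isChar_univ.bracket isChar_univ _ (by decide) (by decide)
  have hc4 : IsChar h30 (Finset.Ici 4) := isChar_univ.transporter hc5 _ (by decide) (by decide)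
  have hc3 : IsChar h30 (Finset.Ici 3) := isChar_univ.bracket hc2 _ (by decide) (by decide)
  have hc1 : IsChar h30 (Finset.Ici 1) := hc2.transporter hc4 _ (by decide) (by decide)
  exact .of_Ici hc1 hc2 hc3 hc4 hc5

theorem hasCharFlag_h31 : HasCharFlag h31 := by
  have hc5 : IsChar h31 (Finset.Ici 5) :=
    isChar_univ.transporter isChar_empty _ (by decide) (by decide)
  have hc2 : IsChar h31 (Finset.Ici 2) := isChar_univ.bracket isChar_univ _ (by decide) (by decide)
  have hc4 : IsChar h31 (Finset.Ici 4) := isChar_univ.transporter hc5 _ (by decide) (by decide)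
  have hc3 : IsChar h31 (Finset.Ici 3) := isChar_univ.bracket hc2 _ (by decide) (by decide)
  have hc1 : IsChar h31 (Finset.Ici 1) := hc2.transporter hc5 _ (by decide) (by decide)
  exact .of_Ici hc1 hc2 hc3 hc4 hc5

theorem hasCharFlag_h32 : HasCharFlag h32 := by
  have hc5 : IsChar h32 (Finset.Ici 5) :=
    isChar_univ.transporter isChar_empty _ (by decide) (by decide)
  have hc2 : IsChar h32 (Finset.Ici 2) := isChar_univ.bracket isChar_univ _ (by decide) (by decide)
  have hc4 : IsChar h32 (Finset.Ici 4) := isChar_univ.transporter hc5 _ (by decide) (by decide)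
  have hc3 : IsChar h32 (Finset.Ici 3) := isChar_univ.bracket hc2 _ (by decide) (by decide)
  have hc1 : IsChar h32 (Finset.Ici 1) := hc2.transporter hc4 _ (by decide) (by decide)
  exact .of_Ici hc1 hc2 hc3 hc4 hc5

/-- The exclusions are necessary: each of the three algebras has an automorphism, its non-diagonal
generator, that sends $e_2$ or $e_3$ to $\pm e_1$ and so moves the span of $e_2,\dots,e_6$. -/
theorem hasCharFlag (h13 : n ≠ h13) (h19 : n ≠ h19plus) (h26 : n ≠ h26minus) : HasCharFlag n := by
  cases n
  case h13 => exact absurd rfl h13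
  case h19plus => exact absurd rfl h19
  case h26minus => exact absurd rfl h26
  exacts [hasCharFlag_h9, hasCharFlag_h10, hasCharFlag_h11, hasCharFlag_h12,
    hasCharFlag_h14, hasCharFlag_h18, hasCharFlag_h21, hasCharFlag_h22,
    hasCharFlag_h23, hasCharFlag_h24, hasCharFlag_h25, hasCharFlag_h27,
    hasCharFlag_h28, hasCharFlag_h29, hasCharFlag_h30, hasCharFlag_h31,
    hasCharFlag_h32]

end Model
/-! ### Matrices of isotropies -/

theorem slice_blockTriangular {n : CSLATName} {σ : Matrix (Fin 6) (Fin 6) ℝ} (hσ : σ ∈ n.Slice) :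
    σ.BlockTriangular OrderDual.toDual := by
  obtain ⟨-, s, rfl⟩ := hσ
  intro i j hij
  have hij : i < j := hij
  cases n <;> fin_cases i <;> fin_cases j <;>
    first | exact absurd hij (by decide) | rfl

/-- If `σ` and `A` are lower triangular, `σ` has nonzero diagonal, and `A` is orthogonal for `σᵀσ`,
then `σA = Dσ` for a diagonal sign matrix `D`. -/
theorem exists_mul_eq_diagonal_mul {ι : Type*} [Fintype ι] [LinearOrder ι] {σ A : Matrix ι ι ℝ}
    (hσ : σ.BlockTriangular OrderDual.toDual) (hdiag : ∀ i, σ i i ≠ 0)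
    (hA : A.BlockTriangular OrderDual.toDual)
    (horth : A.transpose * (σ.transpose * σ) * A = σ.transpose * σ) :
    ∃ d : ι → ℝ, (∀ i, d i * d i = 1) ∧ σ * A = Matrix.diagonal d * σ := by
  have hdet : IsUnit σ.det := by
    rw [Matrix.det_of_isLowerTriangular _ hσ, isUnit_iff_ne_zero]
    exact Finset.prod_ne_zero_iff.2 fun i _ => hdiag i
  have : Invertible σ := σ.invertibleOfIsUnitDet hdet
  -- `O` is orthogonal for the standard inner product, so its transpose is its inverse. The inverse
  -- is again lower triangular, so `O` is triangular on both sides.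
  set O := σ * A * σ⁻¹ with hO
  have hOt : O.BlockTriangular OrderDual.toDual :=
    (hσ.mul hA).mul (Matrix.blockTriangular_inv_of_blockTriangular hσ)
  have hOO : O.transpose * O = 1 := by
    have h1 : O.transpose * O =
        σ⁻¹.transpose * (A.transpose * (σ.transpose * σ) * A) * σ⁻¹ := by
      simp only [hO, Matrix.transpose_mul, Matrix.mul_assoc]
    rw [h1, horth, ← Matrix.mul_assoc, ← Matrix.transpose_mul, Matrix.mul_assoc,
      Matrix.mul_nonsing_inv _ hdet, Matrix.transpose_one, Matrix.mul_one]
  have hinv : O⁻¹ = O.transpose := Matrix.inv_eq_left_inv hOO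
  have : Invertible O := Matrix.invertibleOfIsUnitDet O (Matrix.isUnit_det_of_left_inverse hOO)
  have hOt' : O.transpose.BlockTriangular OrderDual.toDual :=
    hinv ▸ Matrix.blockTriangular_inv_of_blockTriangular hOt
  have hOd : O = Matrix.diagonal fun i => O i i := by
    ext i j
    rcases lt_trichotomy i j with h | rfl | h
    · rw [Matrix.diagonal_apply_ne _ h.ne]
      exact hOt h
    · simp
    · rw [Matrix.diagonal_apply_ne _ h.ne']
      exact hOt' h
  refine ⟨fun i => O i i, fun i => ?_, ?_⟩
  · have := congrFun (congrFun hOO i) i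
    rw [hOd] at this
    simpa using this
  · rw [← hOd, hO, Matrix.nonsing_inv_mul_cancel_right _ _ hdet]

/-! ### The finite group of signs -/

/-- The diagonals of the generators of `D`. -/
def signGenerators : CSLATName → List (Fin 6 → ℤˣ)
  | h9 => [![-1, 1, 1, 1, -1, 1], ![1, -1, 1, 1, -1, -1], ![1, 1, 1, -1, 1, 1]]
  | h10 => [![-1, 1, 1, -1, -1, 1], ![1, -1, 1, -1, 1, -1], ![1, 1, -1, 1, -1, 1]]
  | h11 => [![-1, 1, 1, -1, -1, 1], ![1, -1, 1, -1, 1, -1]]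
  | h12 => [![-1, 1, 1, -1, -1, -1], ![1, -1, 1, -1, 1, 1], ![1, 1, -1, 1, -1, 1]]
  | h14 => [![-1, 1, 1, -1, 1, -1], ![1, -1, 1, -1, -1, 1]]
  | h18 => [![-1, 1, -1, -1, 1, -1], ![1, -1, 1, -1, 1, 1]]
  | h21 => [![-1, 1, 1, -1, 1, -1], ![1, -1, 1, -1, -1, -1], ![1, 1, -1, 1, 1, 1]]
  | h22 => [![-1, 1, 1, -1, 1, -1], ![1, 1, -1, 1, 1, 1]]
  | h23 => [![-1, 1, -1, 1, -1, -1], ![1, -1, -1, -1, 1, -1]]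
  | h24 => [![-1, 1, -1, -1, 1, -1]]
  | h25 => [![-1, 1, -1, -1, 1, -1], ![1, -1, 1, -1, -1, -1]]
  | h27 => [![-1, 1, 1, -1, 1, -1], ![1, -1, 1, -1, -1, -1]]
  | h28 => [![-1, 1, -1, 1, -1, 1], ![1, -1, -1, -1, -1, -1]]
  | h29 => [![-1, -1, 1, -1, 1, -1]]
  | h30 => [![-1, 1, -1, 1, -1, 1]]
  | h31 => [![-1, 1, -1, 1, -1, -1], ![1, -1, -1, -1, -1, 1]]
  | h32 => [![-1, 1, -1, 1, -1, -1]]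
  | h13 | h19plus | h26minus => []

theorem mem_generators_iff {n : CSLATName} (h13 : n ≠ h13) (h19 : n ≠ h19plus)
    (h26 : n ≠ h26minus) (M : Matrix (Fin 6) (Fin 6) ℝ) :
    M ∈ n.generators ↔
      ∃ ε ∈ n.signGenerators, M = Matrix.diagonal fun i => ((ε i : ℤ) : ℝ) := by
  have hd : ∀ a b c d e f : ℤˣ,
      (Matrix.diagonal fun i => ((![a, b, c, d, e, f] i : ℤ) : ℝ)) =
        Matrix.diagonal ![((a : ℤ) : ℝ), ((b : ℤ) : ℝ), ((c : ℤ) : ℝ), ((d : ℤ) : ℝ),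
          ((e : ℤ) : ℝ), ((f : ℤ) : ℝ)] := by
    intro a b c d e f
    congr 1
    funext i
    fin_cases i <;> rfl
  cases n <;> simp_all [generators, signGenerators]

/-- The sign changes of the standard basis that preserve the bracket. -/
def IsAutSign (n : CSLATName) (ε : Fin 6 → ℤˣ) : Prop :=
  ∀ k, ∀ p ∈ n.salamon k, ε k = ε (p.1 - 1) * ε (p.2 - 1)

instance (n : CSLATName) (ε : Fin 6 → ℤˣ) : Decidable (n.IsAutSign ε) :=
  inferInstanceAs (Decidable (∀ _, _))

theorem isAutSign_of_mem_signGenerators (n : CSLATName) :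
    ∀ ε ∈ n.signGenerators, n.IsAutSign ε := by
  cases n <;> decide

/-- Sublists suffice because the generators are commuting involutions. -/
theorem exists_sublist_prod_eq {n : CSLATName} (h13 : n ≠ h13) (h19 : n ≠ h19plus)
    (h26 : n ≠ h26minus) (ε : Fin 6 → ℤˣ) (hε : n.IsAutSign ε) :
    ∃ l ∈ n.signGenerators.sublists, l.prod = ε := by
  -- Splitting the vector into six independent units makes the claim a finite check over $2^6$
  -- cases.
  have hcons : ε = ![ε 0, ε 1, ε 2, ε 3, ε 4, ε 5] := by
    funext i
    fin_cases i <;> rfl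
  rw [hcons] at hε ⊢
  generalize ε 0 = a at *
  generalize ε 1 = b at *
  generalize ε 2 = c at *
  generalize ε 3 = d at *
  generalize ε 4 = e at *
  generalize ε 5 = f at *
  clear hcons
  cases n <;> first
    | contradiction
    | (revert hε; revert a b c d e f; decide +kernel)

open Model

theorem forall_fin_six {p : Fin 6 → Prop} :
    (∀ i, p i) ↔ p 0 ∧ p 1 ∧ p 2 ∧ p 3 ∧ p 4 ∧ p 5 := by
  simp [Fin.forall_fin_succ]

set_option maxHeartbeats 4000000 in
-- All Lie algebras of the list are treated by one Gröbner basis computation each.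
/-- A lower triangular matrix with signs on the diagonal that satisfies the automorphism equations
and preserves `σᵀσ` is diagonal.  The columns of the matrix are the vectors `a j`. -/
theorem apply_eq_zero_of_mem_slice {n : CSLATName} (h13 : n ≠ h13) (h19 : n ≠ h19plus)
    (h26 : n ≠ h26minus) {σ : Matrix (Fin 6) (Fin 6) ℝ} (hσ : σ ∈ n.Slice) (a : Fin 6 → n.Model)
    (haut : ∀ m, ∀ p ∈ n.salamon m, ∀ k, a m k = -(⁅a (p.1 - 1), a (p.2 - 1)⁆ : n.Model) k)
    (hzero : ∀ i j, i < j → (∀ m, ∀ p ∈ n.salamon m,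
        ¬(p.1 - 1 = i ∧ p.2 - 1 = j) ∧ ¬(p.2 - 1 = i ∧ p.1 - 1 = j)) →
      ∀ k, (⁅a i, a j⁆ : n.Model) k = 0)
    (htri : ∀ i j, i < j → a j i = 0) (hone : ∀ i, a i i * a i i = 1)
    (hmul : ∀ i j, j < i → ∑ k, σ i k * a j k = a i i * σ i j) :
    ∀ i j, j < i → a j i = 0 := by
  obtain ⟨hpos, s, rfl⟩ := hσ
  -- Inverses of the diagonal entries encode their nonvanishing as polynomial equations; nothing
  -- more of positivity is needed.
  obtain ⟨t, ht⟩ : ∃ t : Fin 6 → ℝ, ∀ i, t i * n.slice s i i = 1 :=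
    ⟨fun i => (n.slice s i i)⁻¹, fun i => inv_mul_cancel₀ (hpos i).ne'⟩
  clear hpos
  cases n <;> first
    | contradiction
    | (simp [forall_fin_six] at htri hone ⊢
       -- Without `mul_eq_zero`, vanishing products stay polynomial equations instead of becoming
       -- disjunctions.
       simp [-mul_eq_zero, forall_fin_six, Fin.sum_univ_six, slice, htri] at hmul ht
       simp [-mul_eq_zero, forall_fin_six, lie_apply, salamon, htri] at haut hzero
       clear h13 h19 h26 htri
       and_intros <;> grind)


/-- In every tuple a pair $ij$ occurs in one entry only, so a nonzero bracket of standard basis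
vectors is plus or minus a single basis vector. -/
theorem structConst_of_mem_salamon {n : CSLATName} :
    ∀ k, ∀ p ∈ n.salamon k, ∀ l, n.structConst l (p.1 - 1) (p.2 - 1) = if l = k then -1 else 0 := by
  cases n <;> decide

theorem Model.lie_stdBasis_of_mem_salamon {n : CSLATName} {k : Fin 6} {p : Fin 6 × Fin 6}
    (hp : p ∈ n.salamon k) : ⁅n.stdBasis (p.1 - 1), n.stdBasis (p.2 - 1)⁆ = -n.stdBasis k := by
  simp [lie_stdBasis_stdBasis, structConst_of_mem_salamon k p hp]

theorem Model.lie_stdBasis_eq_zero {n : CSLATName} {i j : Fin 6}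
    (h : ∀ m, ∀ p ∈ n.salamon m,
      ¬(p.1 - 1 = i ∧ p.2 - 1 = j) ∧ ¬(p.2 - 1 = i ∧ p.1 - 1 = j)) :
    ⁅n.stdBasis i, n.stdBasis j⁆ = 0 := by
  have hz : ∀ m, n.structConst m i j = 0 := by
    intro m
    rw [structConst, neg_eq_zero]
    refine List.sum_eq_zero fun x hx => ?_
    obtain ⟨p, hp, rfl⟩ := List.mem_map.1 hx
    rw [if_neg (h m p hp).1, if_neg (h m p hp).2, sub_zero]
  simp [lie_stdBasis_stdBasis, hz]

/-- An automorphism of the model that preserves `σᵀσ` acts by signs on the standard basis. -/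
theorem exists_sign {n : CSLATName} (h13 : n ≠ h13) (h19 : n ≠ h19plus) (h26 : n ≠ h26minus)
    {σ : Matrix (Fin 6) (Fin 6) ℝ} (hσ : σ ∈ n.Slice) {f : n.Model ≃ₗ[ℝ] n.Model}
    (hf : f ∈ lieAut n.Model) {A : Matrix (Fin 6) (Fin 6) ℝ}
    (hA : ∀ i j, A i j = f (n.stdBasis j) i)
    (horth : A.transpose * (σ.transpose * σ) * A = σ.transpose * σ) :
    ∃ ε : Fin 6 → ℤˣ, n.IsAutSign ε ∧ A = Matrix.diagonal fun i => ((ε i : ℤ) : ℝ) := by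
  have hflag := hasCharFlag h13 h19 h26
  have htri : ∀ i j, i < j → f (n.stdBasis j) i = 0 := fun i j hij => hflag.apply_eq_zero hf hij
  have hAt : A.BlockTriangular OrderDual.toDual := fun i j hij => by
    rw [hA]
    exact htri i j hij
  have hσt := slice_blockTriangular hσ
  obtain ⟨d, hd, hmul⟩ :=
    exists_mul_eq_diagonal_mul hσt (fun i => (hσ.1 i).ne') hAt horth
  have hmul' : ∀ i j, ∑ k, σ i k * A k j = d i * σ i j := by
    intro i j
    have := congrFun (congrFun hmul i) j
    rwa [Matrix.mul_apply, Matrix.diagonal_mul] at this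
  -- On the diagonal of $\sigma A=\operatorname{diag}(d)\,\sigma$ only the term $k=i$ survives, both
  -- factors being lower triangular.
  have hdiag : ∀ i, A i i = d i := by
    intro i
    have h := hmul' i i
    rw [Finset.sum_eq_single i, mul_comm] at h
    · exact mul_right_cancel₀ (hσ.1 i).ne' h
    · intro k _ hk
      rcases lt_or_gt_of_ne hk with hlt | hlt
      · rw [hAt hlt, mul_zero]
      · rw [hσt hlt, zero_mul]
    · simp
  have hoff : ∀ i j, j < i → f (n.stdBasis j) i = 0 := by
    refine apply_eq_zero_of_mem_slice h13 h19 h26 hσ (fun j => f (n.stdBasis j)) ?_ ?_ htri ?_ ?_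
    · intro m p hp k
      have hm : f (n.stdBasis m) = -⁅f (n.stdBasis (p.1 - 1)), f (n.stdBasis (p.2 - 1))⁆ := by
        rw [← hf, lie_stdBasis_of_mem_salamon hp, map_neg, neg_neg]
      rw [hm]
      rfl
    · intro i j _ hij k
      rw [← hf, lie_stdBasis_eq_zero hij, map_zero, zero_apply]
    · intro i
      simp only [← hA, hdiag, hd]
    · intro i j _
      simp only [← hA, hdiag, hmul']
  have hsign : ∀ i, ∃ u : ℤˣ, ((u : ℤ) : ℝ) = d i := by
    intro i
    rcases mul_self_eq_one_iff.1 (hd i) with h | h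
    · exact ⟨1, by simp [h]⟩
    · exact ⟨-1, by simp [h]⟩
  choose ε hε using hsign
  have hAd : A = Matrix.diagonal fun i => ((ε i : ℤ) : ℝ) := by
    ext i j
    rcases lt_trichotomy i j with h | rfl | h
    · rw [Matrix.diagonal_apply_ne _ h.ne, hA, htri i j h]
    · rw [Matrix.diagonal_apply_eq, hdiag, hε]
    · rw [Matrix.diagonal_apply_ne _ h.ne', hA, hoff i j h]
  refine ⟨ε, ?_, hAd⟩
  have hfe : ∀ i, f (n.stdBasis i) = ((ε i : ℤ) : ℝ) • n.stdBasis i := by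
    intro i
    funext k
    rw [← hA, hAd, Model.smul_apply, stdBasis_apply, Matrix.diagonal_apply]
    split_ifs with h
    · rw [h, mul_one]
    · rw [mul_zero]
  intro k p hp
  -- Applying $f$ to $[e_i,e_j]=-e_k$ and comparing the coefficients of $e_k$ gives
  -- $\varepsilon_k=\varepsilon_i\varepsilon_j$.
  have h := hf (n.stdBasis (p.1 - 1)) (n.stdBasis (p.2 - 1))
  rw [hfe, hfe, smul_lie, lie_smul, smul_smul, lie_stdBasis_of_mem_salamon hp, map_neg, hfe,
    smul_neg, neg_inj] at h
  have hk := congrFun h k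
  rw [Model.smul_apply, Model.smul_apply, stdBasis_apply, if_pos rfl, mul_one, mul_one] at hk
  exact Units.ext (by exact_mod_cast hk)

end CSLATName

/-! ### Transfer from the model to a Lie algebra with a standard basis -/

section

open CSLATName

variable {h : Type*} [LieRing h] [LieAlgebra ℝ h]

/-- The action of sign vectors on a basis. -/
noncomputable def signAction (e : Module.Basis (Fin 6) ℝ h) : (Fin 6 → ℤˣ) →* (h ≃ₗ[ℝ] h) where
  toFun ε := e.equiv (e.unitsSMul fun i => Units.map (Int.castRingHom ℝ).toMonoidHom (ε i))
    (Equiv.refl _)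
  map_one' := e.ext' fun i => by simp [Module.Basis.unitsSMul_apply]
  map_mul' a b := e.ext' fun i => by
    simp [Module.Basis.unitsSMul_apply, Units.smul_def, smul_smul, mul_comm]

theorem signAction_apply (e : Module.Basis (Fin 6) ℝ h) (ε : Fin 6 → ℤˣ) (i : Fin 6) :
    signAction e ε (e i) = ((ε i : ℤ) : ℝ) • e i := by
  simp [signAction, Module.Basis.unitsSMul_apply, Units.smul_def]

theorem toMatrix_eq_diagonal_iff (e : Module.Basis (Fin 6) ℝ h) (φ : h ≃ₗ[ℝ] h)
    (ε : Fin 6 → ℤˣ) :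
    LinearMap.toMatrix e e (φ : h →ₗ[ℝ] h) = (Matrix.diagonal fun i => ((ε i : ℤ) : ℝ)) ↔
      φ = signAction e ε := by
  have hmat : LinearMap.toMatrix e e (signAction e ε : h →ₗ[ℝ] h) =
      Matrix.diagonal fun i => ((ε i : ℤ) : ℝ) := by
    ext i j
    rw [LinearMap.toMatrix_apply, LinearEquiv.coe_coe, signAction_apply]
    simp [Finsupp.single_apply, Matrix.diagonal_apply, eq_comm]
    aesop
  rw [← hmat, EmbeddingLike.apply_eq_iff_eq, LinearEquiv.toLinearMap_inj]

/-- This moves $D$ into the finite group $\{\pm1\}^6$ of exponent two, from which its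
group-theoretic properties are read off. -/
theorem finiteGroupD_eq_map {n : CSLATName} (h13 : n ≠ h13) (h19 : n ≠ h19plus)
    (h26 : n ≠ h26minus) (e : Module.Basis (Fin 6) ℝ h) :
    finiteGroupD n e =
      (Subgroup.closure {ε | ε ∈ n.signGenerators}).map (signAction e) := by
  rw [MonoidHom.map_closure, finiteGroupD]
  congr 1
  ext φ
  simp only [Set.mem_ofPred_eq, mem_generators_iff h13 h19 h26, toMatrix_eq_diagonal_iff,
    Set.mem_image, @eq_comm _ φ]

/-- Each term $x_iy_j-x_jy_i$ of the $k$-th coordinate of the bracket is scaled by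
$\varepsilon_i\varepsilon_j=\varepsilon_k$. -/
theorem signAction_mem_lieAut {n : CSLATName} {e : Module.Basis (Fin 6) ℝ h}
    (he : IsStandardBasis n e) {ε : Fin 6 → ℤˣ} (hε : n.IsAutSign ε) :
    signAction e ε ∈ lieAut h := by
  obtain ⟨ψ, hψ⟩ := he
  have hcoord : ∀ x k, ψ (signAction e ε x) k = ((ε k : ℤ) : ℝ) * ψ x k := by
    intro x k
    rw [← e.sum_repr x]
    simp only [map_sum, map_smul, signAction_apply, hψ, ← Model.stdBasis_repr,
      Finsupp.finsetSum_apply, Finsupp.smul_apply, Module.Basis.repr_self, Finsupp.single_apply,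
      smul_eq_mul, mul_ite, mul_one, mul_zero, Finset.sum_ite_eq', Finset.mem_univ, if_true]
    ring
  intro x y
  apply ψ.injective
  funext k
  change ψ (signAction e ε ⁅x, y⁆) k = ψ ⁅signAction e ε x, signAction e ε y⁆ k
  rw [hcoord, LieEquiv.map_lie, LieEquiv.map_lie, Model.lie_apply, Model.lie_apply, mul_neg,
    ← List.sum_map_mul_left]
  congr 2
  refine List.map_congr_left fun p hp => ?_
  rw [hcoord, hcoord, hcoord, hcoord, hε k p hp]
  push_cast
  ring

theorem toMatrix_of_mem_orthogonalOf {e : Module.Basis (Fin 6) ℝ h}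
    {σ : Matrix (Fin 6) (Fin 6) ℝ} {φ : h ≃ₗ[ℝ] h} (hφ : φ ∈ orthogonalOf (metricOf e σ)) :
    (LinearMap.toMatrix e e (φ : h →ₗ[ℝ] h)).transpose * (σ.transpose * σ) *
      LinearMap.toMatrix e e (φ : h →ₗ[ℝ] h) = σ.transpose * σ := by
  have hcomp : LinearMap.BilinForm.comp (metricOf e σ) (φ : h →ₗ[ℝ] h) (φ : h →ₗ[ℝ] h) = metricOf e σ :=
    LinearMap.ext₂ hφ
  have := congrArg (LinearMap.BilinForm.toMatrix e) hcomp
  rwa [LinearMap.BilinForm.toMatrix_comp e e, metricOf, LinearMap.BilinForm.toMatrix_toBilin] at this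

theorem isotropyGroup_le_map {n : CSLATName} (h13 : n ≠ h13) (h19 : n ≠ h19plus)
    (h26 : n ≠ h26minus) {e : Module.Basis (Fin 6) ℝ h} (he : IsStandardBasis n e)
    {σ : Matrix (Fin 6) (Fin 6) ℝ} (hσ : σ ∈ n.Slice) :
    isotropyGroup e σ ≤ (Subgroup.closure {ε | ε ∈ n.signGenerators}).map (signAction e) := by
  rintro φ ⟨haut, horth⟩
  obtain ⟨ψ, hψ⟩ := he
  have hψ' : ∀ x k, ψ x k = e.repr x k := by
    intro x k
    have : e.map ψ.toLinearEquiv = n.stdBasis := Module.Basis.eq_of_apply_eq fun i => hψ i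
    rw [← Model.stdBasis_repr (ψ x), ← this]
    exact congrArg (fun y => e.repr y k) (ψ.symm_apply_apply x)
  -- The conjugate of `φ` by `ψ` has the same matrix in the canonical basis as `φ` has in `e`.
  let f : n.Model ≃ₗ[ℝ] n.Model := (ψ.toLinearEquiv.symm.trans φ).trans ψ.toLinearEquiv
  have hf : ∀ x, f (ψ x) = ψ (φ x) := fun x => congrArg (fun y => ψ (φ y)) (ψ.symm_apply_apply x)
  have hfaut : f ∈ lieAut n.Model := by
    intro x y
    obtain ⟨x, rfl⟩ : ∃ z, ψ z = x := ψ.surjective x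
    obtain ⟨y, rfl⟩ : ∃ z, ψ z = y := ψ.surjective y
    rw [← LieEquiv.map_lie, hf, hf, hf, haut, LieEquiv.map_lie]
  obtain ⟨ε, hε, hA⟩ := exists_sign h13 h19 h26 hσ hfaut
    (A := LinearMap.toMatrix e e (φ : h →ₗ[ℝ] h))
    (fun i j => by rw [LinearMap.toMatrix_apply, ← hψ, hf, hψ', LinearEquiv.coe_coe])
    (toMatrix_of_mem_orthogonalOf horth)
  refine ⟨ε, ?_, ((toMatrix_eq_diagonal_iff e φ ε).1 hA).symm⟩
  obtain ⟨l, hl, rfl⟩ := exists_sublist_prod_eq h13 h19 h26 ε hε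
  exact list_prod_mem fun x hx => Subgroup.subset_closure ((List.mem_sublists.1 hl).subset hx)

end

theorem mainTheorem6 {h : Type*} [LieRing h] [LieAlgebra ℝ h]
    (hdim : Module.finrank ℝ h = 6) (hC : IsCSLAT h)
    (h13 : IsEmpty (h ≃ₗ⁅ℝ⁆ CSLATName.h13.Model))
    (h19 : IsEmpty (h ≃ₗ⁅ℝ⁆ CSLATName.h19plus.Model))
    (h26 : IsEmpty (h ≃ₗ⁅ℝ⁆ CSLATName.h26minus.Model))
    (n : CSLATName) (e : Module.Basis (Fin 6) ℝ h) (he : IsStandardBasis n e)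
    (σ : Matrix (Fin 6) (Fin 6) ℝ) (hσ : σ ∈ n.Slice) :
    isotropyGroup e σ ≤ finiteGroupD n e ∧
      finiteGroupD n e ≤ lieAut h ∧
      Finite (finiteGroupD n e) ∧
      IsPGroup 2 (finiteGroupD n e) ∧
      ∀ φ ∈ finiteGroupD n e, ∃ ε : Fin 6 → ℝ,
        (∀ i, ε i = 1 ∨ ε i = -1) ∧ ∀ i, φ (e i) = ε i • e i := by
  have hn13 : n ≠ CSLATName.h13 := by
    rintro rfl
    exact h13.elim he.choose
  have hn19 : n ≠ CSLATName.h19plus := by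
    rintro rfl
    exact h19.elim he.choose
  have hn26 : n ≠ CSLATName.h26minus := by
    rintro rfl
    exact h26.elim he.choose
  rw [finiteGroupD_eq_map hn13 hn19 hn26]
  refine ⟨isotropyGroup_le_map hn13 hn19 hn26 he hσ, ?_, ?_, ?_, ?_⟩
  · rw [Subgroup.map_le_iff_le_comap, Subgroup.closure_le]
    exact fun ε hε =>
      signAction_mem_lieAut he (CSLATName.isAutSign_of_mem_signGenerators n ε hε)
  · exact Set.Finite.subset (Set.toFinite (Set.range (signAction e))) (by
      rintro _ ⟨ε, -, rfl⟩
      exact ⟨ε, rfl⟩)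
  -- The exponent $1$ in $2^1$ works for every element, since sign vectors square to one.
  · refine IsPGroup.map (fun ε => ⟨1, ?_⟩) (signAction e)
    ext i
    simp
  · rintro _ ⟨ε, -, rfl⟩
    refine ⟨fun i => ((ε i : ℤ) : ℝ), fun i => ?_, signAction_apply e ε⟩
    rcases Int.units_eq_one_or (ε i) with h | h <;> simp [h]
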